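/- Let $\mathscr P$ be an additive category and $K(\mathscr P)$ the homotopy category of complexes $C=(\cdots\to C_{n+1}\to C_n\to C_{n-1}\to\cdots)$ in $\mathscr P$. Call $C$ *acyclic* if the complex of abelian groups $\operatorname{Hom}_{\mathscr P}(X,C)$ is acyclic for every object $X$ of $\mathscr P$; *totally acyclic* if in addition $\operatorname{Hom}_{\mathscr P}(C,X)$ is acyclic for every $X$; and *eventually acyclic* if for every $X$ one has $H_n(\operatorname{Hom}_{\mathscr P}(X,C))=0$ for all $|n|\gg 0$. Let $K_{\mathrm{tac}}(\mathscr P)$, $K^{-,b}(\mathscr P)$ and $K^b(\mathscr P)$ be the full subcategories of $K(\mathscr P)$ consisting, up to isomorphism in $K(\mathscr P)$, of the totally acyclic complexes, of the eventually acyclic complexes with $C_n=0$ for $n\ll 0$, and of the complexes with $C_n=0$ for $|n|\gg 0$, respectively. The Verdier quotient $K^{-,b}(\mathscr P)/K^b(\mathscr P)$ is the localization of $K^{-,b}(\mathscr P)$ at the morphisms whose mapping cone lies in $K^b(\mathscr P)$. Brutal truncation at degree zero, which replaces $C_n$ by $0$ for all $n<0$, induces a functor $$\beta_{\mathscr P}\colon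 K_{\mathrm{tac}}(\mathscr P)\to K^{-,b}(\mathscr P)/K^b(\mathscr P).$$ **Proposition.** Let $A$ be a left Noetherian ring, let $\operatorname{proj}A$ be the category of finitely generated projective left $A$-modules, and let $D^b_{\mathrm{st}}(A)=K^{-,b}(\operatorname{proj}A)/K^b(\operatorname{proj}A)$ be its stable derived category. If the functor $$\beta_{\operatorname{proj}A}\colon K_{\mathrm{tac}}(\operatorname{proj}A)\to D^b_{\mathrm{st}}(A)$$ is dense (that is, every object of $D^b_{\mathrm{st}}(A)$ is isomorphic to an object in the image of $\beta_{\operatorname{proj}A}$), then for every finitely generated left $A$-module $M$ there is an integer $N\ge 0$ such that $\operatorname{Ext}^n_A(M,A)=0$ for all $n\ge N$. -/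

import Mathlib

open CategoryTheory CategoryTheory.Limits

universe v u

namespace StableDerived

noncomputable section

section AdditiveCategory

variable (P : Type u) [Category.{v} P] [Preadditive P]

/-! ### Complexes in an additive category

Complexes are indexed cohomologically: the component of homological degree `n` of a complex `C`
is `C.X (-n)`, and the differential raises the cohomological degree. -/

variable {P} in
/-- The complex of abelian groups `Hom(X, K)`. -/
abbrev homTo (X : P) (K : CochainComplex P ℤ) :
    HomologicalComplex AddCommGrpCat.{v} (ComplexShape.up ℤ) :=
  ((preadditiveCoyoneda.obj (Opposite.op X)).mapHomologicalComplex _).obj K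

variable {P} in
/-- The complex of abelian groups `Hom(K, X)`; the group `Hom(K.X n, X)` is placed at the index `n`
and the differential lowers `n`. -/
abbrev homFrom (K : CochainComplex P ℤ) (X : P) :
    HomologicalComplex AddCommGrpCat.{v} (ComplexShape.up ℤ).symm :=
  ((preadditiveYoneda.obj X).mapHomologicalComplex _).obj K.op

variable {P} in
/-- `K` is acyclic: `Hom(X, K)` is acyclic for all objects `X`. -/
def IsAcyclic (K : CochainComplex P ℤ) : Prop :=
  ∀ X : P, (homTo X K).Acyclic

variable {P} in
/-- `K` is totally acyclic: `Hom(X, K)` and `Hom(K, X)` are acyclic for all objects `X`. -/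
def IsTotallyAcyclic (K : CochainComplex P ℤ) : Prop :=
  IsAcyclic K ∧ ∀ X : P, (homFrom K X).Acyclic

variable {P} in
/-- `K` is eventually acyclic: for every object `X`, the complex `Hom(X, K)` is exact in all
degrees of sufficiently large absolute value. -/
def IsEventuallyAcyclic (K : CochainComplex P ℤ) : Prop :=
  ∀ X : P, ∃ N : ℤ, ∀ n : ℤ, N < |n| → (homTo X K).ExactAt n

variable {P} in
/-- `K` vanishes in all sufficiently small homological (that is, in all sufficiently large
cohomological) degrees. -/
def IsRightBounded (K : CochainComplex P ℤ) : Prop :=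
  ∃ N : ℤ, ∀ n : ℤ, N < n → IsZero (K.X n)

variable {P} in
/-- `K` vanishes in all degrees of sufficiently large absolute value. -/
def IsBounded (K : CochainComplex P ℤ) : Prop :=
  ∃ N : ℤ, ∀ n : ℤ, N < |n| → IsZero (K.X n)

/-! ### Full subcategories of the homotopy category -/

/-- The totally acyclic objects of the homotopy category. This property is invariant under
homotopy equivalence, see the instance below. -/
def tac : ObjectProperty (HomotopyCategory P (ComplexShape.up ℤ)) :=
  fun K => IsTotallyAcyclic K.as

/-- The objects of `K^{-,b}(P)`: those isomorphic in the homotopy category to a right bounded,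
eventually acyclic complex. -/
def minusB : ObjectProperty (HomotopyCategory P (ComplexShape.up ℤ)) :=
  fun K => ∃ L : CochainComplex P ℤ, IsRightBounded L ∧ IsEventuallyAcyclic L ∧
    Nonempty (K ≅ (HomotopyCategory.quotient P (ComplexShape.up ℤ)).obj L)

/-- The objects of `K^b(P)`: those isomorphic in the homotopy category to a bounded complex. -/
def bdd : ObjectProperty (HomotopyCategory P (ComplexShape.up ℤ)) :=
  fun K => ∃ L : CochainComplex P ℤ, IsBounded L ∧
    Nonempty (K ≅ (HomotopyCategory.quotient P (ComplexShape.up ℤ)).obj L)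

/-- `K_tac(P)`, the homotopy category of totally acyclic complexes. -/
abbrev KTac := (tac P).FullSubcategory

/-- `K^{-,b}(P)`, the homotopy category of right bounded, eventually acyclic complexes. -/
abbrev KMinusB := (minusB P).FullSubcategory

variable {P} in
lemma isTotallyAcyclic_of_homotopyEquiv {K L : CochainComplex P ℤ} (e : HomotopyEquiv K L)
    (hK : IsTotallyAcyclic K) : IsTotallyAcyclic L := by
  refine ⟨fun X n => ?_, fun X n => ?_⟩
  · have h := hK.1 X n
    rw [HomologicalComplex.exactAt_iff_isZero_homology] at h ⊢
    exact h.of_iso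
      (((preadditiveCoyoneda.obj (Opposite.op X)).mapHomotopyEquiv e).toHomologyIso n).symm
  · have h := hK.2 X n
    rw [HomologicalComplex.exactAt_iff_isZero_homology] at h ⊢
    let e' : HomotopyEquiv L.op K.op :=
      { hom := (HomologicalComplex.opFunctor P _).map e.hom.op
        inv := (HomologicalComplex.opFunctor P _).map e.inv.op
        homotopyHomInvId := e.homotopyInvHomId.op
        homotopyInvHomId := e.homotopyHomInvId.op }
    exact h.of_iso (((preadditiveYoneda.obj X).mapHomotopyEquiv e').toHomologyIso n)

instance : (tac P).IsClosedUnderIsomorphisms where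
  of_iso {K L} e hK :=
    isTotallyAcyclic_of_homotopyEquiv
      (HomotopyCategory.homotopyEquivOfIso (C := K.as) (D := L.as) e) hK

variable [HasZeroObject P]

/-! ### Brutal truncation -/

variable {P} in
/-- The brutal truncation of `K` which keeps the cohomological degrees `≤ n`, that is, the
homological degrees `≥ -n`. -/
abbrev brutal (K : CochainComplex P ℤ) (n : ℤ) : CochainComplex P ℤ :=
  K.stupidTrunc (ComplexShape.embeddingUpIntLE n)

variable {P} in
/-- The map induced by a chain map on brutal truncations. -/
abbrev brutalMap {K L : CochainComplex P ℤ} (f : K ⟶ L) (n : ℤ) : brutal K n ⟶ brutal L n :=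
  HomologicalComplex.stupidTruncMap f (ComplexShape.embeddingUpIntLE n)

section Auxiliary

variable {P}
variable (K L : CochainComplex P ℤ) (n : ℤ)

lemma emb_f (i : ℤ) (h : i ≤ n) :
    (ComplexShape.embeddingUpIntLE n).f (n - i).toNat = i := by
  simp only [ComplexShape.embeddingUpIntLE_f]
  omega

lemma isZero_brutal (i : ℤ) (h : n < i) : IsZero ((brutal K n).X i) :=
  HomologicalComplex.isZero_stupidTrunc_X _ _ _
    ((ComplexShape.notMem_range_embeddingUpIntLE_iff n i).2 h)

/-- The terms of a brutal truncation in the degrees which are kept. -/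
def brutalXIso (i : ℤ) (h : i ≤ n) : (brutal K n).X i ≅ K.X i :=
  K.stupidTruncXIso _ (emb_f n i h)

lemma stupidTrunc_d {ι ι' : Type} {c : ComplexShape ι} {c' : ComplexShape ι'}
    (K : HomologicalComplex P c') (e : c.Embedding c') [e.IsRelIff] {i j : ι} {i' j' : ι'}
    (hi : e.f i = i') (hj : e.f j = j') :
    (K.stupidTrunc e).d i' j' ≫ (K.stupidTruncXIso e hj).hom =
      (K.stupidTruncXIso e hi).hom ≫ K.d i' j' := by
  subst hi hj
  have h : (K.stupidTrunc e).d (e.f i) (e.f j) =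
      (K.stupidTruncXIso e rfl).hom ≫ K.d (e.f i) (e.f j) ≫ (K.stupidTruncXIso e rfl).inv := by
    have h1 := HomologicalComplex.extend_d_eq (K.restriction e) e (i := i) (j := j) rfl rfl
    have h2 : (K.stupidTruncXIso e (i := i) rfl) = (K.restriction e).extendXIso e rfl := by
      ext; exact Category.comp_id _
    have h3 : (K.stupidTruncXIso e (i := j) rfl) = (K.restriction e).extendXIso e rfl := by
      ext; exact Category.comp_id _
    rw [h2, h3]
    exact h1
  rw [h, Category.assoc, Category.assoc, Iso.inv_hom_id, Category.comp_id]

lemma brutal_d (i j : ℤ) (hi : i ≤ n) (hj : j ≤ n) :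
    (brutal K n).d i j ≫ (brutalXIso K n j hj).hom =
      (brutalXIso K n i hi).hom ≫ K.d i j :=
  stupidTrunc_d _ _ _ _

/-- Degreewise inclusion of a brutal truncation. -/
def inc (i : ℤ) : (brutal K n).X i ⟶ K.X i :=
  if h : i ≤ n then (brutalXIso K n i h).hom else 0

/-- Degreewise projection to a brutal truncation. -/
def prj (i : ℤ) : K.X i ⟶ (brutal K n).X i :=
  if h : i ≤ n then (brutalXIso K n i h).inv else 0

lemma inc_prj (i : ℤ) : inc K n i ≫ prj K n i = 𝟙 _ := by
  by_cases h : i ≤ n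
  · simp [inc, prj, h]
  · exact (isZero_brutal K n i (by omega)).eq_of_src _ _

lemma prj_inc (i : ℤ) (h : i ≤ n) : prj K n i ≫ inc K n i = 𝟙 _ := by
  simp [inc, prj, h]

lemma inc_d (i j : ℤ) (hij : i + 1 = j) (hj : j ≤ n) :
    inc K n i ≫ K.d i j = (brutal K n).d i j ≫ inc K n j := by
  have hi : i ≤ n := by omega
  simp only [inc, dif_pos hi, dif_pos hj, brutal_d K n i j hi hj]

lemma prj_d (i j : ℤ) (hij : i + 1 = j) :
    prj K n i ≫ (brutal K n).d i j = K.d i j ≫ prj K n j := by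
  by_cases hj : j ≤ n
  · rw [← cancel_mono (𝟙 _), ← inc_prj K n j]
    simp only [Category.assoc]
    rw [← reassoc_of% (inc_d K n i j hij hj), reassoc_of% (prj_inc K n i (by omega)),
      reassoc_of% (prj_inc K n j hj)]
  · exact (isZero_brutal K n j (by omega)).eq_of_tgt _ _

variable {K L}

lemma prj_map (f : K ⟶ L) (i : ℤ) :
    prj K n i ≫ (brutalMap f n).f i = f.f i ≫ prj L n i := by
  by_cases h : i ≤ n
  · have := HomologicalComplex.stupidTruncMap_stupidTruncXIso_hom f
      (ComplexShape.embeddingUpIntLE n) (emb_f n i h)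
    simp only [prj, dif_pos h]
    rw [Iso.inv_comp_eq, ← Category.assoc, Iso.eq_comp_inv]
    exact this
  · exact (isZero_brutal L n i (by omega)).eq_of_tgt _ _

variable (K)

/-- The projection between two successive brutal truncations. -/
def step : brutal K (n + 1) ⟶ brutal K n where
  f i := inc K (n + 1) i ≫ prj K n i
  comm' i j hij := by
    simp only [ComplexShape.up_Rel] at hij
    by_cases hj : j ≤ n
    · rw [Category.assoc, prj_d K n i j hij, reassoc_of% (inc_d K (n + 1) i j hij (by omega))]
    · exact (isZero_brutal K n j (by omega)).eq_of_tgt _ _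

/-- The inclusion of the kernel of the projection between successive truncations. -/
def kerStep : (HomologicalComplex.single P (ComplexShape.up ℤ) (n + 1)).obj (K.X (n + 1)) ⟶
    brutal K (n + 1) :=
  HomologicalComplex.mkHomFromSingle (prj K (n + 1) (n + 1)) (fun k hk => by
    simp only [ComplexShape.up_Rel] at hk
    exact (isZero_brutal K (n + 1) k (by omega)).eq_of_tgt _ _)

/-- The degreewise split short exact sequence of successive truncations. -/
@[simps]
def stepSeq : ShortComplex (CochainComplex P ℤ) where
  X₁ := (HomologicalComplex.single P (ComplexShape.up ℤ) (n + 1)).obj (K.X (n + 1))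
  X₂ := brutal K (n + 1)
  X₃ := brutal K n
  f := kerStep K n
  g := step K n
  zero := by
    apply HomologicalComplex.hom_ext
    intro i
    by_cases h : i = n + 1
    · exact (isZero_brutal K n i (by omega)).eq_of_tgt _ _
    · exact (HomologicalComplex.isZero_single_obj_X (ComplexShape.up ℤ) (n + 1) _ i
        h).eq_of_src _ _

/-- The degreewise splittings. -/
def stepSplitting (i : ℤ) :
    ((stepSeq K n).map (HomologicalComplex.eval P _ i)).Splitting :=
  if h : i = n + 1 then
    ShortComplex.Splitting.ofIsIsoOfIsZero _
      (by
        subst h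
        change IsIso ((kerStep K n).f (n + 1))
        rw [kerStep, HomologicalComplex.mkHomFromSingle_f]
        have : IsIso (prj K (n + 1) (n + 1)) :=
          ⟨inc K (n + 1) (n + 1), prj_inc K _ _ le_rfl, inc_prj K _ _⟩
        infer_instance)
      (isZero_brutal K n i (by omega))
  else
    ShortComplex.Splitting.ofIsZeroOfIsIso _
      (HomologicalComplex.isZero_single_obj_X (ComplexShape.up ℤ) (n + 1) _ i h)
      (by
        change IsIso (inc K (n + 1) i ≫ prj K n i)
        by_cases hi : i ≤ n
        · refine ⟨inc K n i ≫ prj K (n + 1) i, ?_, ?_⟩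
          · rw [Category.assoc, reassoc_of% (prj_inc K n i hi), inc_prj]
          · rw [Category.assoc, reassoc_of% (prj_inc K (n + 1) i (by omega)), inc_prj]
        · exact (isZero_brutal K (n + 1) i (by omega)).isIso
            (isZero_brutal K n i (by omega)) _)

variable {K}

/-- Homotopic maps become homotopic on truncations after precomposition with the projection
from the next larger truncation. -/
def stepHomotopy {f g : K ⟶ L} (h : Homotopy f g) :
    Homotopy (step K n ≫ brutalMap f n) (step K n ≫ brutalMap g n) where
  hom i j := inc K (n + 1) i ≫ h.hom i j ≫ prj L n j
  zero i j hij := by rw [h.zero i j hij]; simp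
  comm i := by
    by_cases hi : i ≤ n
    · have h1 : (ComplexShape.up ℤ).Rel i (i + 1) := rfl
      have h2 : (ComplexShape.up ℤ).Rel (i - 1) i := by simp
      rw [dNext_eq _ h1, prevD_eq _ h2]
      have := h.comm i
      rw [dNext_eq _ h1, prevD_eq _ h2] at this
      simp only [HomologicalComplex.comp_f, step, Category.assoc]
      rw [prj_map, prj_map, this, prj_d L n (i - 1) i (by simp),
        ← reassoc_of% (inc_d K (n + 1) i (i + 1) rfl (by omega))]
      simp only [Preadditive.add_comp, Preadditive.comp_add, Category.assoc]
    · exact (isZero_brutal L n i (by omega)).eq_of_tgt _ _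

lemma exactAt_brutal (X : P) (i : ℤ) (hi : i < n) (h : (homTo X K).ExactAt i) :
    (homTo X (brutal K n)).ExactAt i := by
  rw [HomologicalComplex.exactAt_iff' _ (i - 1) i (i + 1) (by simp) (by simp)] at h ⊢
  refine (ShortComplex.exact_iff_of_iso ?_).2 h
  refine ShortComplex.isoMk
    ((preadditiveCoyoneda.obj (Opposite.op X)).mapIso (brutalXIso K n (i - 1) (by omega)))
    ((preadditiveCoyoneda.obj (Opposite.op X)).mapIso (brutalXIso K n i (by omega)))
    ((preadditiveCoyoneda.obj (Opposite.op X)).mapIso (brutalXIso K n (i + 1) (by omega))) ?_ ?_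
  · have := brutal_d K n (i - 1) i (by omega) (by omega)
    exact (((preadditiveCoyoneda.obj (Opposite.op X)).map_comp _ _).symm.trans
      (congrArg _ this.symm)).trans ((preadditiveCoyoneda.obj (Opposite.op X)).map_comp _ _)
  · have := brutal_d K n i (i + 1) (by omega) (by omega)
    exact (((preadditiveCoyoneda.obj (Opposite.op X)).map_comp _ _).symm.trans
      (congrArg _ this.symm)).trans ((preadditiveCoyoneda.obj (Opposite.op X)).map_comp _ _)

end Auxiliary

variable {P} in
/-- The brutal truncation of a totally acyclic complex lies in `K^{-,b}(P)`. -/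
lemma minusB_brutal (K : CochainComplex P ℤ) (hK : IsTotallyAcyclic K) :
    minusB P ((HomotopyCategory.quotient P (ComplexShape.up ℤ)).obj (brutal K 0)) := by
  refine ⟨brutal K 0, ⟨0, fun n hn => isZero_brutal K 0 n hn⟩, fun X => ⟨0, fun n hn => ?_⟩,
    ⟨Iso.refl _⟩⟩
  rcases lt_or_gt_of_ne (abs_pos.1 hn) with h | h
  · exact exactAt_brutal 0 X n h (hK.1 X n)
  · exact HomologicalComplex.ExactAt.of_isZero
      ((preadditiveCoyoneda.obj (Opposite.op X)).map_isZero (isZero_brutal K 0 n h))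

variable [HasBinaryBiproducts P]

/-! ### The Verdier quotient and the truncation functor -/

/-- The morphisms of `K^{-,b}(P)` whose mapping cone lies in `K^b(P)`. -/
def coneBdd : MorphismProperty (KMinusB P) :=
  (bdd P).trW.inverseImage (minusB P).ι

/-- The Verdier quotient `K^{-,b}(P) / K^b(P)`, that is, the localization of `K^{-,b}(P)` at the
morphisms whose mapping cone lies in `K^b(P)`. -/
abbrev VerdierQuotient := (coneBdd P).Localization

variable {P} in
lemma trW_step (K : CochainComplex P ℤ) (n : ℤ) :
    (bdd P).trW ((HomotopyCategory.quotient P (ComplexShape.up ℤ)).map (step K n)) := by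
  have hT := (HomotopyCategory.distinguished_iff_iso_trianglehOfDegreewiseSplit
    (CochainComplex.trianglehOfDegreewiseSplit (stepSeq K n) (stepSplitting K n))).2
      ⟨_, _, ⟨Iso.refl _⟩⟩
  refine ⟨_, _, _, Pretriangulated.rot_of_distTriang _ hT,
    ((HomologicalComplex.single P (ComplexShape.up ℤ) (n + 1)).obj (K.X (n + 1)))⟦(1 : ℤ)⟧,
    ⟨|n| + 1, fun i hi => ?_⟩,
    ⟨(((HomotopyCategory.quotient P (ComplexShape.up ℤ)).commShiftIso (1 : ℤ)).app _).symm⟩⟩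
  refine HomologicalComplex.isZero_single_obj_X (ComplexShape.up ℤ) (n + 1) _ (i + 1) ?_
  intro h
  have : i = n := by omega
  subst this
  omega

/-- The truncation of a totally acyclic complex at degree zero, as an object of `K^{-,b}(P)`. -/
def brutalObj (K : KTac P) : KMinusB P :=
  ⟨(HomotopyCategory.quotient P (ComplexShape.up ℤ)).obj (brutal K.obj.as 0),
    minusB_brutal K.obj.as K.property⟩

variable {P} in
/-- The morphism of `K^{-,b}(P)` given by the truncation at degree zero of a chain map. -/
def brutalHom {K L : KTac P} (f : K.obj.as ⟶ L.obj.as) : brutalObj P K ⟶ brutalObj P L :=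
  ObjectProperty.homMk ((HomotopyCategory.quotient P (ComplexShape.up ℤ)).map (brutalMap f 0))

variable {P} in
/-- Truncations of homotopic chain maps agree in the Verdier quotient. -/
lemma brutalHom_eq_of_homotopy {K L : KTac P} {f g : K.obj.as ⟶ L.obj.as} (h : Homotopy f g) :
    (coneBdd P).Q.map (brutalHom f) = (coneBdd P).Q.map (brutalHom g) := by
  have hmem : minusB P
      ((HomotopyCategory.quotient P (ComplexShape.up ℤ)).obj (brutal K.obj.as (0 + 1))) := by
    refine ⟨brutal K.obj.as (0 + 1), ⟨1, fun n hn => isZero_brutal _ _ n (by omega)⟩,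
      fun X => ⟨1, fun n hn => ?_⟩, ⟨Iso.refl _⟩⟩
    rcases lt_abs.1 hn with h | h
    · exact HomologicalComplex.ExactAt.of_isZero
        ((preadditiveCoyoneda.obj (Opposite.op X)).map_isZero (isZero_brutal _ _ n (by omega)))
    · exact exactAt_brutal _ X n (by omega) (K.property.1 X n)
  let s : (⟨_, hmem⟩ : KMinusB P) ⟶ brutalObj P K :=
    ObjectProperty.homMk ((HomotopyCategory.quotient P (ComplexShape.up ℤ)).map
      (step K.obj.as 0))
  have hs : coneBdd P s := trW_step K.obj.as 0
  have : IsIso ((coneBdd P).Q.map s) := (coneBdd P).Q_inverts s hs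
  rw [← cancel_epi ((coneBdd P).Q.map s), ← Functor.map_comp, ← Functor.map_comp]
  congr 1
  apply ObjectProperty.hom_ext
  change (HomotopyCategory.quotient P _).map _ ≫ (HomotopyCategory.quotient P _).map _ =
    (HomotopyCategory.quotient P _).map _ ≫ (HomotopyCategory.quotient P _).map _
  rw [← Functor.map_comp, ← Functor.map_comp]
  exact HomotopyCategory.eq_of_homotopy _ _ (stepHomotopy 0 h)

/-- The functor `K_tac(P) ⥤ K^{-,b}(P) / K^b(P)` induced by brutal truncation at degree zero: it
sends a totally acyclic complex to its truncation, and the homotopy class of a chain map `f` to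
the class of the truncation of `f`. -/
def truncationFunctor : KTac P ⥤ VerdierQuotient P where
  obj K := (coneBdd P).Q.obj (brutalObj P K)
  map {K L} f := (coneBdd P).Q.map (brutalHom (Quot.out f.hom))
  map_id K := by
    refine (brutalHom_eq_of_homotopy (f := Quot.out (𝟙 K : K ⟶ K).hom) (g := 𝟙 K.obj.as)
      (HomotopyCategory.homotopyOutMap (𝟙 K.obj.as))).trans ?_
    rw [← CategoryTheory.Functor.map_id]
    congr 1
    apply ObjectProperty.hom_ext
    change (HomotopyCategory.quotient P _).map (brutalMap (𝟙 K.obj.as) 0) = 𝟙 _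
    rw [brutalMap, HomologicalComplex.stupidTruncMap_id, CategoryTheory.Functor.map_id]
  map_comp {K L M} f g := by
    rw [← Functor.map_comp, brutalHom_eq_of_homotopy (f := Quot.out (f ≫ g).hom)
      (g := Quot.out f.hom ≫ Quot.out g.hom)
      (HomotopyCategory.homotopyOfEq _ _ (by
        rw [HomotopyCategory.quotient_map_out, HomotopyCategory.quotient_map_out_comp_out]
        rfl))]
    congr 1
    apply ObjectProperty.hom_ext
    change (HomotopyCategory.quotient P _).map (brutalMap _ 0) =
      (HomotopyCategory.quotient P _).map _ ≫ (HomotopyCategory.quotient P _).map _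
    rw [brutalMap, HomologicalComplex.stupidTruncMap_comp, Functor.map_comp]

variable {P} in
/-- On the class of a chain map the functor is given by the truncation of that map. -/
lemma truncationFunctor_map {K L : KTac P} (f : K.obj.as ⟶ L.obj.as) :
    (truncationFunctor P).map
        (ObjectProperty.homMk ((HomotopyCategory.quotient P (ComplexShape.up ℤ)).map f) : K ⟶ L) =
      (coneBdd P).Q.map (brutalHom f) :=
  brutalHom_eq_of_homotopy (HomotopyCategory.homotopyOutMap f)

end AdditiveCategory

/-! ### Finitely generated projective modules -/

section Modules

variable (A : Type u) [Ring A]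

/-- Finitely generated projective left `A`-modules. -/
def fgProj : ObjectProperty (ModuleCat.{u} A) :=
  fun M => Module.Finite A M ∧ Module.Projective A M

/-- The category `proj A` of finitely generated projective left `A`-modules. -/
abbrev ProjMod := (fgProj A).FullSubcategory

instance : (fgProj A).IsClosedUnderIsomorphisms where
  of_iso e h := by
    obtain ⟨_, _⟩ := h
    exact ⟨Module.Finite.equiv e.toLinearEquiv, Module.Projective.of_equiv e.toLinearEquiv⟩

instance : (fgProj A).ContainsZero where
  exists_zero := ⟨ModuleCat.of A PUnit.{u + 1}, ModuleCat.isZero_of_subsingleton _,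
    inferInstanceAs (Module.Finite A PUnit.{u + 1}), inferInstanceAs (Module.Projective A PUnit.{u + 1})⟩

instance : (fgProj A).IsClosedUnderBinaryProducts :=
  .mk' (by
    rintro _ ⟨F, hF⟩
    have h1 := hF ⟨WalkingPair.left⟩
    have h2 := hF ⟨WalkingPair.right⟩
    obtain ⟨_, _⟩ := h1
    obtain ⟨_, _⟩ := h2
    refine (fgProj A).prop_of_iso (((ModuleCat.biprodIsoProd (F.obj ⟨WalkingPair.left⟩)
      (F.obj ⟨WalkingPair.right⟩)).symm ≪≫ biprod.isoProd _ _) ≪≫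
        HasLimit.isoOfNatIso (diagramIsoPair F).symm) ?_
    exact ⟨inferInstanceAs (Module.Finite A (_ × _)),
      inferInstanceAs (Module.Projective A (_ × _))⟩)

instance : (fgProj A).IsClosedUnderFiniteProducts :=
  ObjectProperty.IsClosedUnderFiniteProducts.mk'

instance : HasBinaryBiproducts (ProjMod A) :=
  HasBinaryBiproducts.of_hasBinaryProducts

/-- The stable derived category `D^b_st(A) = K^{-,b}(proj A) / K^b(proj A)`. -/
abbrev StableDerivedCategory := VerdierQuotient (ProjMod A)

/-- The functor `β : K_tac(proj A) ⥤ D^b_st(A)`. -/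
abbrev betaProj : KTac (ProjMod A) ⥤ StableDerivedCategory A :=
  truncationFunctor (ProjMod A)

end Modules

end

end StableDerived

/-! Fix `X` in `P` and consider whether `Hom(L, X[n])`, taken in the homotopy category, vanishes for
`n ≫ 0`. Truncations of totally acyclic complexes have this property
(`eventually_hom_brutal_eq_zero`): in low cohomological degrees the truncation agrees with `K`, and
`Hom(K, X)` is acyclic.

The property is also invariant under isomorphism in the Verdier quotient. A single functor `Hom(-,
X[n])` need not factor through the quotient, but germs at infinity of sequences in `∏ Hom(-, X[n])`
do: a morphism with bounded cone induces bijections for all large `n`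
(`eventually_bijective_of_trW`). The universal property of localization then suffices, without a
calculus of fractions.

If `β` is dense, every object of `K^{-,b}` therefore has the property. Over a left Noetherian ring
this covers the resolution of `M` by finitely generated projectives, where with `X = A` the groups
in question control `Ext^n(M, A)` (`subsingleton_ext`). -/

namespace StableDerived

noncomputable section

/-! ### Germs at infinity of sequences of morphisms -/

section TailHom

variable {C D : Type*} [Category C] [Category.{v} D]

/-- The contravariant functor sending `X` to the set of sequences of morphisms `X ⟶ S n`, two
sequences being identified when they agree for all large `n`. -/
def tailHom (S : ℕ → D) : D ⥤ (Type v)ᵒᵖ where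
  obj X := Opposite.op (Filter.Product Filter.atTop (fun n => X ⟶ S n))
  map {X Y} f := Quiver.Hom.op (TypeCat.ofHom (Quotient.map
    (fun (φ : ∀ n, Y ⟶ S n) n => f ≫ φ n)
    (fun _ _ h => h.mono (fun n hn => congrArg (f ≫ ·) hn))))
  map_id X := by
    apply Quiver.Hom.unop_inj
    ext x
    induction x using Quotient.inductionOn with | h x =>
    exact congrArg (Quotient.mk _) (funext fun n => Category.id_comp (x n))
  map_comp f g := by
    apply Quiver.Hom.unop_inj
    ext x
    induction x using Quotient.inductionOn with | h x =>
    exact congrArg (Quotient.mk _) (funext fun n => Category.assoc f g (x n))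

/-- Germs ignore finitely many indices, so eventual bijectivity is enough. Nonemptiness supplies
filler values at the exceptional indices. -/
lemma isIso_tailHom_map (S : ℕ → D) {X Y : D} (f : X ⟶ Y)
    (hf : ∀ᶠ n in Filter.atTop, Function.Bijective (fun g : Y ⟶ S n => f ≫ g))
    (hY : ∀ n, Nonempty (Y ⟶ S n)) :
    IsIso ((tailHom S).map f) := by
  rw [← isIso_unop_iff, isIso_iff_bijective]
  constructor
  · intro x y
    induction x, y using Quotient.inductionOn₂ with | h x y =>
    intro h
    have h' : ∀ᶠ n in Filter.atTop, f ≫ x n = f ≫ y n := Quotient.exact h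
    refine Quotient.sound ?_
    filter_upwards [hf, h'] with n hn hn'
    exact hn.1 hn'
  · intro x
    induction x using Quotient.inductionOn with | h x =>
    -- Where bijectivity fails, `g` is arbitrary; the germ does not see it.
    have (n : ℕ) : ∃ g : Y ⟶ S n, Function.Bijective (fun g : Y ⟶ S n => f ≫ g) →
        f ≫ g = x n := by
      by_cases h : Function.Bijective (fun g : Y ⟶ S n => f ≫ g)
      · obtain ⟨g, hg⟩ := h.2 (x n)
        exact ⟨g, fun _ => hg⟩
      · exact ⟨(hY n).some, fun h' => (h h').elim⟩
    choose g hg using this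
    refine ⟨Quotient.mk _ g, Quotient.sound ?_⟩
    filter_upwards [hf] with n hn
    exact hg n hn

/-- Makes eventual vanishing readable from the germ set alone, hence transportable along
isomorphisms. -/
lemma subsingleton_tailHom_iff [HasZeroMorphisms D] (S : ℕ → D) (X : D) :
    Subsingleton ((tailHom S).obj X).unop ↔
      ∀ᶠ n in Filter.atTop, ∀ f : X ⟶ S n, f = 0 := by
  constructor
  · intro h
    -- Choose `f n` nonzero whenever possible; if its germ equals that of zero, almost all the Hom
    -- sets are trivial.
    have (n : ℕ) : ∃ f : X ⟶ S n, f = 0 → ∀ g : X ⟶ S n, g = 0 := by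
      by_cases h : ∀ g : X ⟶ S n, g = 0
      · exact ⟨0, fun _ => h⟩
      · obtain ⟨g, hg⟩ := not_forall.1 h
        exact ⟨g, fun h => (hg h).elim⟩
    choose f hf using this
    have h0 : ∀ᶠ n in Filter.atTop, f n = 0 :=
      Quotient.exact (h.elim (Quotient.mk _ f) (Quotient.mk _ fun n => 0))
    exact h0.mono hf
  · intro h
    refine ⟨fun x y => ?_⟩
    induction x, y using Quotient.inductionOn₂ with | h x y =>
    refine Quotient.sound ?_
    filter_upwards [h] with n hn
    rw [hn (x n), hn (y n)]

/-- The eventual vanishing of `Hom(-, S n)` is invariant under isomorphisms in a localization,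
provided that the localized morphisms eventually induce bijections on `Hom(-, S n)`. -/
lemma eventually_eq_zero_of_iso_localization [HasZeroMorphisms D] (G : C ⥤ D) (S : ℕ → D)
    (W : MorphismProperty C)
    (hW : ∀ ⦃X Y : C⦄ (f : X ⟶ Y), W f → ∀ᶠ n in Filter.atTop,
      Function.Bijective (fun g : G.obj Y ⟶ S n => G.map f ≫ g))
    {X Y : C} (e : W.Q.obj X ≅ W.Q.obj Y)
    (hX : ∀ᶠ n in Filter.atTop, ∀ f : G.obj X ⟶ S n, f = 0) :
    ∀ᶠ n in Filter.atTop, ∀ f : G.obj Y ⟶ S n, f = 0 := by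
  have hinv : W.IsInvertedBy (G ⋙ tailHom S) := fun _ _ f hf =>
    isIso_tailHom_map S (G.map f) (hW f hf) (fun _ => ⟨0⟩)
  let F := Localization.Construction.lift (G ⋙ tailHom S) hinv
  let e' : (tailHom S).obj (G.obj X) ≅ (tailHom S).obj (G.obj Y) := F.mapIso e
  rw [← subsingleton_tailHom_iff] at hX ⊢
  exact e'.unop.toEquiv.subsingleton

end TailHom

/-! ### Morphisms in the homotopy category to a complex concentrated in one degree -/

section Single

variable {P : Type u} [Category.{v} P] [Preadditive P] [HasZeroObject P]

/-- `X` placed in cohomological degree `i`, as an object of the homotopy category. -/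
abbrev singleK (X : P) (i : ℤ) : HomotopyCategory P (ComplexShape.up ℤ) :=
  (HomotopyCategory.quotient P (ComplexShape.up ℤ)).obj
    ((HomologicalComplex.single P (ComplexShape.up ℤ) i).obj X)

open CochainComplex.HomComplex in
/-- Morphisms to a complex concentrated in degree `i` vanish up to homotopy if and only if
every cocycle is a coboundary. -/
lemma hom_singleK_eq_zero_iff (K : CochainComplex P ℤ) (X : P) (i j k : ℤ) (hij : i + 1 = j)
    (hjk : j + 1 = k) :
    (∀ f : (HomotopyCategory.quotient P (ComplexShape.up ℤ)).obj K ⟶ singleK X j, f = 0) ↔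
      ∀ f : K.X j ⟶ X, K.d i j ≫ f = 0 → ∃ g : K.X k ⟶ X, K.d j k ≫ g = f := by
  constructor
  · intro h f hf
    let φ : K ⟶ (HomologicalComplex.single P (ComplexShape.up ℤ) j).obj X :=
      HomologicalComplex.mkHomToSingle f (fun l hl => by
        obtain rfl : l = i := by simp only [ComplexShape.up_Rel] at hl; omega
        exact hf)
    have hφ := HomotopyCategory.homotopyOfEq φ 0 ((h _).trans (Functor.map_zero _ _ _).symm)
    have hc := hφ.comm j
    rw [dNext_eq _ (show (ComplexShape.up ℤ).Rel j k from hjk),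
      prevD_eq _ (show (ComplexShape.up ℤ).Rel i j from hij)] at hc
    -- The other term of the homotopy relation passes through a differential of the single complex,
    -- which is zero.
    refine ⟨hφ.hom k j ≫ (HomologicalComplex.singleObjXSelf _ j X).hom, ?_⟩
    rw [← cancel_mono (HomologicalComplex.singleObjXSelf (ComplexShape.up ℤ) j X).inv]
    simpa [φ] using hc.symm
  · intro h f
    obtain ⟨φ, rfl⟩ := (HomotopyCategory.quotient P (ComplexShape.up ℤ)).map_surjective f
    obtain ⟨g, hg⟩ := h (φ.f j ≫ (HomologicalComplex.singleObjXSelf _ j X).hom) (by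
      rw [← φ.comm_assoc]; simp)
    -- The homotopy is the degree `-1` cochain whose only component is `g`. Its coboundary is `K.d j
    -- k ≫ g` in degree `j`, with sign `+1`, and a map to a single complex is determined by that
    -- component.
    have key (ψ : K ⟶ (CochainComplex.singleFunctor P j).obj X)
        (hψ : K.d j k ≫ g = ψ.f j ≫ (HomologicalComplex.singleObjXSelf _ j X).hom) :
        Cochain.ofHom ψ =
          δ (-1) 0 (Cochain.toSingleMk g (by omega : k + (-1) = j)) + Cochain.ofHom 0 := by
      rw [Cochain.δ_toSingleMk g _ 0 j (by omega), hψ]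
      apply (Cochain.toSingleEquiv (show j + 0 = j by omega)).injective
      simp only [Cochain.toSingleEquiv, Int.negOnePow_zero, one_smul, Cochain.ofHom_zero,
        add_zero, AddEquiv.coe_mk, Equiv.coe_fn_mk, Cochain.ofHom_v, Cochain.toSingleMk_v]
      exact (((Category.assoc _ _ _).trans (congrArg _ (Iso.inv_hom_id _))).trans
        (Category.comp_id _)).symm
    rw [← Functor.map_zero]
    exact HomotopyCategory.eq_of_homotopy _ _
      ((Cochain.equivHomotopy φ 0).symm ⟨_, key φ hg⟩)

lemma hom_singleK_eq_zero_of_isZero (K : CochainComplex P ℤ) (X : P) (i : ℤ)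
    (h : IsZero (K.X i))
    (f : (HomotopyCategory.quotient P (ComplexShape.up ℤ)).obj K ⟶ singleK X i) : f = 0 :=
  (hom_singleK_eq_zero_iff K X (i - 1) i (i + 1) (by omega) rfl).2
    (fun g _ => ⟨0, h.eq_of_src _ _⟩) f

variable (P) in
omit [HasZeroObject P] in
lemma bdd_shift (Z : HomotopyCategory P (ComplexShape.up ℤ)) (hZ : bdd P Z) (a : ℤ) :
    bdd P (Z⟦a⟧) := by
  obtain ⟨L, ⟨N, hN⟩, ⟨e⟩⟩ := hZ
  refine ⟨L⟦a⟧, ⟨N + |a|, fun n hn => hN (n + a) ?_⟩,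
    ⟨(shiftFunctor _ a).mapIso e ≪≫
      (((HomotopyCategory.quotient P (ComplexShape.up ℤ)).commShiftIso a).app L).symm⟩⟩
  have := abs_sub_abs_le_abs_sub n (-a)
  rw [abs_neg, sub_neg_eq_add] at this
  omega

lemma eventually_hom_singleK_eq_zero_of_bdd (X : P)
    {Z : HomotopyCategory P (ComplexShape.up ℤ)} (hZ : bdd P Z) :
    ∀ᶠ n : ℕ in Filter.atTop, ∀ f : Z ⟶ singleK X (-n), f = 0 := by
  obtain ⟨L, ⟨N, hN⟩, ⟨e⟩⟩ := hZ
  filter_upwards [Filter.eventually_gt_atTop N.toNat] with n hn f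
  rw [← cancel_epi e.inv, comp_zero]
  refine hom_singleK_eq_zero_of_isZero L X _ (hN _ ?_) _
  rw [abs_neg, Nat.abs_cast]
  omega

/-! ### Eventual vanishing in the Verdier quotient -/

variable [HasBinaryBiproducts P]

open Pretriangulated in
/-- A morphism with bounded cone induces bijections on `Hom(-, X[n])` for large `n`. -/
lemma eventually_bijective_of_trW (X : P) {K L : HomotopyCategory P (ComplexShape.up ℤ)}
    (f : K ⟶ L) (hf : (bdd P).trW f) :
    ∀ᶠ n : ℕ in Filter.atTop,
      Function.Bijective (fun g : L ⟶ singleK X (-n) => f ≫ g) := by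
  obtain ⟨Z, g, h, hT, hZ⟩ := hf
  -- In the long exact sequence, `Hom(Z, X[n]) = 0` gives injectivity and `Hom(Z[-1], X[n]) = 0`
  -- gives surjectivity.
  filter_upwards [eventually_hom_singleK_eq_zero_of_bdd X hZ,
    eventually_hom_singleK_eq_zero_of_bdd X (bdd_shift P Z hZ (-1))] with n h₀ h₁
  constructor
  · intro a b hab
    obtain ⟨c, hc⟩ := Triangle.yoneda_exact₂ _ hT (a - b) (by
      change f ≫ (a - b) = 0
      rw [Preadditive.comp_sub, sub_eq_zero]
      exact hab)
    exact sub_eq_zero.1 (hc.trans ((congrArg (g ≫ ·) (h₀ c)).trans comp_zero))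
  · intro a
    obtain ⟨b, hb⟩ := Triangle.yoneda_exact₂ _ (inv_rot_of_distTriang _ hT) a (h₁ _)
    exact ⟨b, hb.symm⟩

omit [HasBinaryBiproducts P] in
/-- The cohomology of `Hom(brutal K 0, X)` vanishes in large degrees if `K` is totally acyclic. -/
lemma eventually_hom_brutal_eq_zero (K : CochainComplex P ℤ) (hK : IsTotallyAcyclic K) (X : P) :
    ∀ᶠ n : ℕ in Filter.atTop,
      ∀ f : (HomotopyCategory.quotient P (ComplexShape.up ℤ)).obj (brutal K 0) ⟶
        singleK X (-n), f = 0 := by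
  -- Strict positivity keeps degree `-n + 1` inside the truncation; at `n = 0` the outgoing
  -- differential is cut off.
  filter_upwards [Filter.eventually_gt_atTop 0] with n hn
  rw [hom_singleK_eq_zero_iff _ _ (-(n : ℤ) - 1) (-n) (-n + 1) (by omega) rfl]
  intro f hf
  have hex := hK.2 X (-(n : ℤ))
  rw [HomologicalComplex.exactAt_iff' _ (-(n : ℤ) + 1) (-n) (-n - 1)
    (ComplexShape.prev_eq' _ (by simp)) (ComplexShape.next_eq' _ (by simp)),
    ShortComplex.ab_exact_iff] at hex
  -- Pull the cocycle back to `K` along `prj`, solve there by total acyclicity, and restrict the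
  -- solution along `inc`.
  obtain ⟨(g : K.X (-(n : ℤ) + 1) ⟶ X), hg⟩ := hex (prj K 0 (-(n : ℤ)) ≫ f) (by
    change K.d (-(n : ℤ) - 1) (-n) ≫ prj K 0 (-(n : ℤ)) ≫ f = 0
    rw [← reassoc_of% (prj_d K 0 (-(n : ℤ) - 1) (-n) (by omega)), hf, comp_zero])
  change K.d (-(n : ℤ)) (-n + 1) ≫ g = (prj K 0 (-(n : ℤ)) ≫ f : K.X (-(n : ℤ)) ⟶ X) at hg
  refine ⟨inc K 0 (-(n : ℤ) + 1) ≫ g, ?_⟩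
  rw [← reassoc_of% (inc_d K 0 (-(n : ℤ)) (-n + 1) rfl (by omega)), hg, reassoc_of% (inc_prj K 0)]

/-- If the truncation functor is dense, then for every complex in `K^{-,b}(P)` the cohomology of
`Hom(-, X)` vanishes in large degrees. -/
lemma eventually_hom_singleK_eq_zero_of_essSurj (h : (truncationFunctor P).EssSurj)
    (L : KMinusB P) (X : P) :
    ∀ᶠ n : ℕ in Filter.atTop, ∀ f : L.obj ⟶ singleK X (-n), f = 0 := by
  obtain ⟨K, ⟨e⟩⟩ := h.mem_essImage ((coneBdd P).Q.obj L)
  exact eventually_eq_zero_of_iso_localization (minusB P).ι (fun n : ℕ => singleK X (-n))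
    (coneBdd P) (fun _ _ f hf => eventually_bijective_of_trW X f.hom hf) (X := brutalObj P K) e
    (eventually_hom_brutal_eq_zero K.obj.as K.property X)

end Single

/-! ### Resolutions by finitely generated projectives over a Noetherian ring -/

section Resolution

variable {A : Type u} [Ring A]

lemma exists_fgProj_epi (M : ModuleCat.{u} A) [Module.Finite A M] :
    ∃ (F : ProjMod A) (p : F.obj ⟶ M), Function.Surjective p := by
  obtain ⟨n, f, hf⟩ := Module.Finite.exists_fin' A M
  exact ⟨⟨ModuleCat.of A (Fin n → A), inferInstanceAs (Module.Finite A (Fin n → A)),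
    inferInstanceAs (Module.Projective A (Fin n → A))⟩, ModuleCat.ofHom f, hf⟩

/-- A finitely generated projective module covering `M`. -/
def cover (M : ModuleCat.{u} A) [Module.Finite A M] : ProjMod A :=
  (exists_fgProj_epi M).choose

/-- The projection of the chosen cover. -/
def coverπ (M : ModuleCat.{u} A) [Module.Finite A M] : (cover M).obj ⟶ M :=
  (exists_fgProj_epi M).choose_spec.choose

lemma coverπ_surjective (M : ModuleCat.{u} A) [Module.Finite A M] :
    Function.Surjective (coverπ M) :=
  (exists_fgProj_epi M).choose_spec.choose_spec

variable [IsNoetherianRing A]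

/-- The iterated syzygies of a finitely generated module with respect to the chosen covers. -/
def syzygy (M : ModuleCat.{u} A) [Module.Finite A M] :
    ℕ → { N : ModuleCat.{u} A // Module.Finite A N }
  | 0 => ⟨M, inferInstance⟩
  | n + 1 =>
    letI N := (syzygy M n).1
    haveI : Module.Finite A N := (syzygy M n).2
    haveI : Module.Finite A (cover N).obj := (cover N).property.1
    -- Noetherianity enters here: the kernel is a submodule of a finitely generated module.
    ⟨ModuleCat.of A (LinearMap.ker (coverπ N).hom), inferInstanceAs (Module.Finite A
      (LinearMap.ker (coverπ N).hom))⟩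

instance (M : ModuleCat.{u} A) [Module.Finite A M] (n : ℕ) : Module.Finite A (syzygy M n).1 :=
  (syzygy M n).2

variable (M : ModuleCat.{u} A) [Module.Finite A M]

/-- The inclusion of a syzygy in the preceding term of the resolution. -/
def syzygyι (n : ℕ) : (syzygy M (n + 1)).1 ⟶ (cover (syzygy M n).1).obj :=
  ModuleCat.ofHom (LinearMap.ker (coverπ (syzygy M n).1).hom).subtype

lemma syzygyι_injective (n : ℕ) : Function.Injective (syzygyι M n) :=
  Subtype.val_injective

lemma exact_syzygyι_coverπ (n : ℕ) :
    Function.Exact (syzygyι M n) (coverπ (syzygy M n).1) := fun x =>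
  ⟨fun hx => ⟨⟨x, hx⟩, rfl⟩, by rintro ⟨y, rfl⟩; exact y.2⟩

/-- The differential of the resolution by finitely generated projective modules. -/
def resolutionD (n : ℕ) : cover (syzygy M (n + 1)).1 ⟶ cover (syzygy M n).1 :=
  ObjectProperty.homMk (coverπ (syzygy M (n + 1)).1 ≫ syzygyι M n)

/-- Each differential is a surjection onto a syzygy followed by its inclusion, so its kernel is that
of the cover and its image is the syzygy. -/
lemma exact_resolutionD (n : ℕ) :
    Function.Exact (resolutionD M (n + 1)).hom (resolutionD M n).hom := by
  intro x
  change syzygyι M n (coverπ (syzygy M (n + 1)).1 x) = 0 ↔ _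
  rw [map_eq_zero_iff _ (syzygyι_injective M n), exact_syzygyι_coverπ M (n + 1) x]
  constructor
  · rintro ⟨y, rfl⟩
    obtain ⟨z, rfl⟩ := coverπ_surjective _ y
    exact ⟨z, rfl⟩
  · rintro ⟨z, rfl⟩
    exact ⟨coverπ _ z, rfl⟩

lemma exact_resolutionD_coverπ :
    Function.Exact (resolutionD M 0).hom (coverπ (syzygy M 0).1) := by
  intro x
  rw [exact_syzygyι_coverπ M 0 x]
  constructor
  · rintro ⟨y, rfl⟩
    obtain ⟨z, rfl⟩ := coverπ_surjective _ y
    exact ⟨z, rfl⟩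
  · rintro ⟨z, rfl⟩
    exact ⟨coverπ _ z, rfl⟩

/-- A resolution of `M` by finitely generated projective modules, as a complex in `proj A`. -/
def resolution : ChainComplex (ProjMod A) ℕ :=
  ChainComplex.of (fun n => cover (syzygy M n).1) (resolutionD M) (fun n => by
    apply ObjectProperty.hom_ext
    ext x
    exact (exact_resolutionD M n).apply_apply_eq_zero x)

lemma resolution_d (n : ℕ) : (resolution M).d (n + 1) n = resolutionD M n :=
  ChainComplex.of_d (fun n => cover (syzygy M n).1) (resolutionD M) n

instance : (fgProj A).ι.Additive where

/-- The complex of modules underlying `resolution M`. -/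
abbrev resolutionModuleCat : ChainComplex (ModuleCat.{u} A) ℕ :=
  ((fgProj A).ι.mapHomologicalComplex _).obj (resolution M)

lemma resolutionModuleCat_exactAt_succ (n : ℕ) : (resolutionModuleCat M).ExactAt (n + 1) := by
  rw [HomologicalComplex.exactAt_iff' _ (n + 2) (n + 1) n (by simp) (by simp),
    ShortComplex.ShortExact.moduleCat_exact_iff_function_exact]
  have := exact_resolutionD M n
  rw [← resolution_d, ← resolution_d] at this
  exact this

/-- The projective resolution of `M` by finitely generated projective modules. -/
def projectiveResolution : ProjectiveResolution M where
  complex := resolutionModuleCat M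
  projective n :=
    have := (cover (syzygy M n).1).property.2
    inferInstanceAs (Projective (cover (syzygy M n).1).obj)
  π := (ChainComplex.toSingle₀Equiv _ _).symm ⟨coverπ (syzygy M 0).1, by
    change ((resolution M).d 1 0).hom ≫ _ = 0
    rw [resolution_d]
    ext x
    exact (exact_resolutionD_coverπ M).apply_apply_eq_zero x⟩
  quasiIso := ⟨fun n => by
    cases n
    -- In degree zero a quasi-isomorphism amounts to exactness at the first cover together with
    -- surjectivity onto `M`.
    · rw [ChainComplex.quasiIsoAt₀_iff, ShortComplex.quasiIso_iff_of_zeros']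
      · refine ⟨?_, ?_⟩
        · rw [ShortComplex.ShortExact.moduleCat_exact_iff_function_exact]
          have := exact_resolutionD_coverπ M
          rw [← resolution_d] at this
          exact this
        · exact (ModuleCat.epi_iff_surjective _).2 (coverπ_surjective (syzygy M 0).1)
      all_goals rfl
    · rw [quasiIsoAt_iff_exactAt']
      · apply resolutionModuleCat_exactAt_succ
      · apply ChainComplex.exactAt_succ_single_obj⟩

/-! ### The resolution as an object of `K^{-,b}(proj A)`, and Ext -/

/-- The resolution of `M`, extended by zero to a complex indexed by `ℤ`. -/
abbrev resolutionInt : CochainComplex (ProjMod A) ℤ :=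
  (resolution M).extend ComplexShape.embeddingDownNat

/-- The terms of `resolutionInt M` in nonpositive degrees. -/
def resolutionIntXIso (i : ℤ) (n : ℕ) (h : -(n : ℤ) = i) :
    (resolutionInt M).X i ≅ (resolution M).X n :=
  (resolution M).extendXIso ComplexShape.embeddingDownNat h

lemma resolutionInt_d (i j : ℤ) (m n : ℕ) (hi : -(m : ℤ) = i) (hj : -(n : ℤ) = j) :
    (resolutionInt M).d i j ≫ (resolutionIntXIso M j n hj).hom =
      (resolutionIntXIso M i m hi).hom ≫ (resolution M).d m n := by
  rw [HomologicalComplex.extend_d_eq _ ComplexShape.embeddingDownNat (i := m) (j := n) hi hj]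
  simp [resolutionIntXIso]

lemma isZero_resolutionInt (i : ℤ) (hi : 0 < i) : IsZero ((resolutionInt M).X i) :=
  (resolution M).isZero_extend_X _ _ (fun n hn => by
    change -(n : ℤ) = i at hn
    omega)

/-- Projectivity of `X` turns exactness of modules into exactness of `Hom(X, -)`. -/
lemma exists_lift_resolution (X : ProjMod A) (n : ℕ) (f : X ⟶ (resolution M).X (n + 1))
    (hf : f ≫ (resolution M).d (n + 1) n = 0) :
    ∃ g : X ⟶ (resolution M).X (n + 2), g ≫ (resolution M).d (n + 2) (n + 1) = f := by
  have := X.property.2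
  have hex := resolutionModuleCat_exactAt_succ M n
  rw [HomologicalComplex.exactAt_iff' _ (n + 2) (n + 1) n (by simp) (by simp)] at hex
  have hf' : f.hom ≫ ((resolution M).d (n + 1) n).hom = 0 :=
    congrArg (fun φ => φ.hom) hf
  exact ⟨ObjectProperty.homMk (hex.liftFromProjective f.hom hf'),
    ObjectProperty.hom_ext _ (hex.liftFromProjective_comp f.hom hf')⟩

/-- Negative degrees follow from lifting along the resolution; in positive degrees the terms vanish.
Degree `0` is excluded because the resolution has homology `M` there. -/
lemma exactAt_homTo_resolutionInt (X : ProjMod A) (i : ℤ) (hi : i ≠ 0) :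
    (homTo X (resolutionInt M)).ExactAt i := by
  rcases lt_or_gt_of_ne hi with h | h
  · obtain ⟨n, hn⟩ : ∃ n : ℕ, -((n + 1 : ℕ) : ℤ) = i := ⟨(-i - 1).toNat, by omega⟩
    have h₁ : -((n + 2 : ℕ) : ℤ) = i - 1 := by omega
    have h₂ : -(n : ℤ) = i + 1 := by omega
    rw [HomologicalComplex.exactAt_iff' _ (i - 1) i (i + 1) (by simp) (by simp),
      ShortComplex.ab_exact_iff]
    intro (f : X ⟶ (resolutionInt M).X i) hf
    change f ≫ (resolutionInt M).d i (i + 1) = 0 at hf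
    obtain ⟨g, hg⟩ := exists_lift_resolution M X n (f ≫ (resolutionIntXIso M i _ hn).hom) (by
      rw [Category.assoc, ← resolutionInt_d M i (i + 1) _ _ hn h₂, reassoc_of% hf, zero_comp])
    refine ⟨(g ≫ (resolutionIntXIso M (i - 1) _ h₁).inv : X ⟶ _), ?_⟩
    change (g ≫ (resolutionIntXIso M (i - 1) _ h₁).inv) ≫ (resolutionInt M).d (i - 1) i = f
    rw [← cancel_mono (resolutionIntXIso M i _ hn).hom, Category.assoc, Category.assoc,
      resolutionInt_d M (i - 1) i _ _ h₁ hn, Iso.inv_hom_id_assoc, hg]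
  · exact HomologicalComplex.ExactAt.of_isZero
      ((preadditiveCoyoneda.obj (Opposite.op X)).map_isZero (isZero_resolutionInt M i h))

lemma minusB_resolutionInt :
    minusB (ProjMod A) ((HomotopyCategory.quotient _ (ComplexShape.up ℤ)).obj (resolutionInt M)) :=
  ⟨resolutionInt M, ⟨0, isZero_resolutionInt M⟩,
    fun X => ⟨0, fun n hn => exactAt_homTo_resolutionInt M X n (abs_pos.1 hn)⟩, ⟨Iso.refl _⟩⟩

/-- `Ext^n(M, N)` vanishes if the resolution of `M` has no morphisms to `N[n]` in the homotopy
category. -/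
lemma subsingleton_ext (N : ProjMod A) (n : ℕ)
    (h : ∀ f : (HomotopyCategory.quotient _ (ComplexShape.up ℤ)).obj (resolutionInt M) ⟶
      singleK N (-((n + 1 : ℕ) : ℤ)), f = 0) :
    Subsingleton (Abelian.Ext M N.obj (n + 1)) := by
  refine subsingleton_of_forall_eq 0 (fun α => ?_)
  -- A class is represented by a cocycle on the term of index `n + 1`, and it is zero exactly when
  -- this cocycle factors through the differential to the term of index `n`.
  obtain ⟨f, hf, rfl⟩ := (projectiveResolution M).extMk_surjective α (n + 2) rfl
  rw [ProjectiveResolution.extMk_eq_zero_iff _ _ _ _ _ n rfl]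
  have h₀ : -(n : ℤ) = -((n + 1 : ℕ) : ℤ) + 1 := by omega
  have h₂ : -((n + 2 : ℕ) : ℤ) = -((n + 1 : ℕ) : ℤ) - 1 := by omega
  let f' : (resolution M).X (n + 1) ⟶ N := ObjectProperty.homMk f
  have hf' : (resolution M).d (n + 2) (n + 1) ≫ f' = 0 := ObjectProperty.hom_ext _ hf
  obtain ⟨g, hg⟩ := (hom_singleK_eq_zero_iff _ _ (-((n + 1 : ℕ) : ℤ) - 1) _ _ (by omega) rfl).1 h
    ((resolutionIntXIso M _ _ rfl).hom ≫ f') (by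
      rw [← Category.assoc, resolutionInt_d M _ _ _ _ h₂ rfl, Category.assoc, hf', comp_zero])
  let g' : (resolution M).X n ⟶ N := (resolutionIntXIso M _ _ h₀).inv ≫ g
  have hg' : (resolution M).d (n + 1) n ≫ g' = f' := by
    rw [← cancel_epi (resolutionIntXIso M _ (n + 1) rfl).hom, ← hg, ← Category.assoc,
      ← resolutionInt_d M _ _ _ _ rfl h₀, Category.assoc, Iso.hom_inv_id_assoc]
  exact ⟨g'.hom, congrArg (fun φ => φ.hom) hg'⟩

end Resolution

end

end StableDerived

theorem proposition2p3 {A : Type u} [Ring A] [IsNoetherianRing A]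
    (hdense : (StableDerived.betaProj A).EssSurj)
    (M : Type u) [AddCommGroup M] [Module A M] [Module.Finite A M] :
    ∃ N : ℕ, ∀ n : ℕ, N ≤ n →
      Subsingleton (Abelian.Ext (ModuleCat.of A M) (ModuleCat.of A A) n) := by
  have : Module.Finite A (ModuleCat.of A M) := inferInstanceAs (Module.Finite A M)
  let R : StableDerived.ProjMod A := ⟨ModuleCat.of A A, inferInstanceAs (Module.Finite A A),
    inferInstanceAs (Module.Projective A A)⟩
  obtain ⟨N, hN⟩ := Filter.eventually_atTop.1
    (StableDerived.eventually_hom_singleK_eq_zero_of_essSurj hdense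
      ⟨_, StableDerived.minusB_resolutionInt (ModuleCat.of A M)⟩ R)
  -- The shift by one makes `n` positive, as `subsingleton_ext` requires.
  refine ⟨N + 1, fun n hn => ?_⟩
  obtain ⟨m, rfl⟩ : ∃ m, n = m + 1 := ⟨n - 1, by omega⟩
  exact StableDerived.subsingleton_ext _ R m (hN _ (by omega))
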